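/- For $\xi\in\mathbb R$ and $a\in\mathbb C$ with $\Re(a)>-1$ and $\Re(a)\neq 0$, the integral $$J(a,\xi)=\int_{-\infty}^{\infty}\Gamma(a-it)\,\Gamma(a+it)\,e^{-it\xi}\,dt$$ converges absolutely. For every real $\xi$ and every purely imaginary $p\neq 0$, the two limits below exist (with $a$ tending to $p$ in the open right, respectively left, half-plane), and the jump of $J(\cdot,\xi)$ across the imaginary axis at $p$ is $$[[J(p,\xi)]]:=\lim_{\substack{a\to p\\ \Re(a)>0}}J(a,\xi)-\lim_{\substack{a\to p\\ \Re(a)<0}}J(a,\xi)=4\pi\cosh(p\xi)\,\Gamma(2p).$$ -/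

import Mathlib

open Filter Topology MeasureTheory

noncomputable section

/-- The function `t ↦ Γ(a - it) Γ(a + it) e^{-itξ}` of the real variable `t`. -/
def gammaIntegrand (a : ℂ) (ξ : ℝ) (t : ℝ) : ℂ :=
  Complex.Gamma (a - Complex.I * t) * Complex.Gamma (a + Complex.I * t) *
    Complex.exp (-(Complex.I * t * ξ))

/-- `J(a, ξ) = ∫ Γ(a - it) Γ(a + it) e^{-itξ} dt` over the real line. -/
def J (a : ℂ) (ξ : ℝ) : ℂ :=
  ∫ t : ℝ, gammaIntegrand a ξ t

/-- The two one-sided limits of `f` at `p`, from the open right and from the open left half-plane,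
exist, and the right one minus the left one is `j`. For `p` on the imaginary axis these
limits are unique, and so is `j`. -/
def HasJumpAcrossImaginaryAxis (f : ℂ → ℂ) (p j : ℂ) : Prop :=
  ∃ Lright Lleft : ℂ,
    Tendsto f (𝓝[{a : ℂ | 0 < a.re}] p) (𝓝 Lright) ∧
    Tendsto f (𝓝[{a : ℂ | a.re < 0}] p) (𝓝 Lleft) ∧
    Lright - Lleft = j

end

/-! Shifting both factors by `Γ(z + 1) = z Γ(z)` turns the integrand into `Γ(a+1-it) Γ(a+1+it) / (a²
+ t²)`, regular in the Gamma factors for `-1 < re a`. The Gamma product is `Γ(2a+2)` times the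
Fourier transform of `sechPow (a + 1)` (a beta integral), and `1 / (a² + t²)` has Fourier transform
`(π/α) e^{-α|u|}`, where `α = ±a` has positive real part. Fubini gives the convolution
`J_eq_integral_sechPow`, where only `α` depends on the side of the axis.

This formula extends continuously to the axis from each side (`tendsto_J_halfPlane`). In the jump
the two kernels add up to `e^{-p|x|} + e^{p|x|} = e^{px} + e^{-px}`: the absolute value disappears,
and what remains are values of the Fourier transform of `sechPow (p + 1)`, each a Gamma product with
one factor `Γ(1)`. -/

open scoped FourierTransform

/-! ### Powers of sech and the beta integral. -/

/-- The function `s ↦ (2 cosh (s / 2)) ^ (-2 b)`, written as `(σ(s) (1 - σ(s))) ^ b` with `σ` the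
sigmoid function. -/
noncomputable def sechPow (b : ℂ) (s : ℝ) : ℂ :=
  ((Real.sigmoid s * (1 - Real.sigmoid s) : ℝ) : ℂ) ^ b

lemma sigmoid_mul_one_sub_pos (s : ℝ) : 0 < Real.sigmoid s * (1 - Real.sigmoid s) :=
  mul_pos (Real.sigmoid_pos s) (sub_pos.2 (Real.sigmoid_lt_one s))

lemma sigmoid_mul_one_sub_le_one (s : ℝ) : Real.sigmoid s * (1 - Real.sigmoid s) ≤ 1 := by
  nlinarith [Real.sigmoid_pos s, Real.sigmoid_lt_one s]

lemma norm_sechPow (b : ℂ) (s : ℝ) :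
    ‖sechPow b s‖ = (Real.sigmoid s * (1 - Real.sigmoid s)) ^ b.re :=
  Complex.norm_cpow_eq_rpow_re_of_pos (sigmoid_mul_one_sub_pos s) b

lemma continuous_sechPow (b : ℂ) : Continuous (sechPow b) := by
  unfold sechPow
  refine Continuous.cpow ?_ continuous_const fun s =>
    Complex.ofReal_mem_slitPlane.2 (sigmoid_mul_one_sub_pos s)
  exact Complex.continuous_ofReal.comp
    (continuous_sigmoid.mul (continuous_const.sub continuous_sigmoid))

lemma continuous_sechPow_left (s : ℝ) : Continuous fun b => sechPow b s :=
  continuous_const.cpow continuous_id fun _ =>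
    Complex.ofReal_mem_slitPlane.2 (sigmoid_mul_one_sub_pos s)

/-- The base lies in `(0, 1]`. This supplies a dominating function uniform in the exponent. -/
lemma norm_sechPow_le {b c : ℂ} (h : c.re ≤ b.re) (s : ℝ) : ‖sechPow b s‖ ≤ ‖sechPow c s‖ := by
  rw [norm_sechPow, norm_sechPow]
  exact Real.rpow_le_rpow_of_exponent_ge (sigmoid_mul_one_sub_pos s)
    (sigmoid_mul_one_sub_le_one s) h

lemma sigmoid_eq_exp_mul (s : ℝ) :
    Real.sigmoid s = (1 - Real.sigmoid s) * Real.exp s := by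
  rw [← Real.sigmoid_neg, ← Real.sigmoid_mul_rexp_neg, mul_assoc, ← Real.exp_add]
  simp

/-- The integrand of the beta integral after the substitution `x = σ(s)`. -/
lemma sigmoid_smul_beta_integrand (b : ℂ) (t s : ℝ) :
    |Real.sigmoid s * (1 - Real.sigmoid s)| •
      ((Real.sigmoid s : ℂ) ^ (b + Complex.I * t - 1) *
        (1 - (Real.sigmoid s : ℂ)) ^ (b - Complex.I * t - 1)) =
      sechPow b s * Complex.exp (Complex.I * t * s) := by
  have hx := Real.sigmoid_pos s
  have hy : 0 < 1 - Real.sigmoid s := sub_pos.2 (Real.sigmoid_lt_one s)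
  have hlog : Real.log (Real.sigmoid s) = Real.log (1 - Real.sigmoid s) + s := by
    conv_lhs => rw [sigmoid_eq_exp_mul s]
    rw [Real.log_mul hy.ne' (Real.exp_pos s).ne', Real.log_exp]
  unfold sechPow
  generalize Real.sigmoid s = x at *
  rw [abs_of_pos (mul_pos hx hy), Complex.real_smul,
    show (1 - (x : ℂ)) = ((1 - x : ℝ) : ℂ) by push_cast; rfl,
    Complex.cpow_sub _ _ (by exact_mod_cast hx.ne'),
    Complex.cpow_sub _ _ (by exact_mod_cast hy.ne'), Complex.cpow_one, Complex.cpow_one,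
    Complex.ofReal_mul, Complex.mul_cpow_ofReal_nonneg hx.le hy.le,
    Complex.cpow_add _ _ (by exact_mod_cast hx.ne'),
    Complex.cpow_sub _ _ (by exact_mod_cast hy.ne')]
  have hq : ((1 - x : ℝ) : ℂ) ^ (Complex.I * t) ≠ 0 := by
    simp [Complex.cpow_eq_zero_iff, hy.ne', -Complex.ofReal_sub]
  -- Since `log x - log (1 - x) = s`, the imaginary powers combine into a pure exponential in `s`.
  have hxt : (x : ℂ) ^ (Complex.I * t) =
      ((1 - x : ℝ) : ℂ) ^ (Complex.I * t) * Complex.exp (Complex.I * t * s) := by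
    rw [Complex.cpow_def_of_ne_zero (by exact_mod_cast hx.ne'),
      Complex.cpow_def_of_ne_zero (by exact_mod_cast hy.ne'), ← Complex.exp_add,
      ← Complex.ofReal_log hx.le, ← Complex.ofReal_log hy.le, hlog]
    congr 1
    push_cast
    ring
  have hx' : (x : ℂ) ≠ 0 := by exact_mod_cast hx.ne'
  have hy' : ((1 - x : ℝ) : ℂ) ≠ 0 := by exact_mod_cast hy.ne'
  rw [hxt]
  field_simp

lemma integrable_sechPow {b : ℂ} (hb : 0 < b.re) : Integrable (sechPow b) := by
  have h := Complex.betaIntegral_convergent hb hb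
  rw [intervalIntegrable_iff_integrableOn_Ioo_of_le zero_le_one, ← Real.range_sigmoid,
    ← Set.image_univ, integrableOn_image_iff_integrableOn_abs_deriv_smul MeasurableSet.univ
      (fun x _ => (Real.hasDerivAt_sigmoid x).hasDerivWithinAt)
      Real.sigmoid_injective.injOn, integrableOn_univ] at h
  refine h.congr (ae_of_all _ fun s => ?_)
  simpa using sigmoid_smul_beta_integrand b 0 s

/-- `Γ(b - it) Γ(b + it) / Γ(2b)` is the Fourier transform of `sechPow b`. -/
lemma Gamma_mul_Gamma_eq_integral_sechPow {b : ℂ} (hb : 0 < b.re) (t : ℝ) :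
    Complex.Gamma (b - Complex.I * t) * Complex.Gamma (b + Complex.I * t) =
      Complex.Gamma (2 * b) * ∫ s : ℝ, sechPow b s * Complex.exp (Complex.I * t * s) := by
  rw [mul_comm, Complex.Gamma_mul_Gamma_eq_betaIntegral (by simpa using hb) (by simpa using hb),
    Complex.betaIntegral, intervalIntegral.integral_of_le zero_le_one,
    integral_Ioc_eq_integral_Ioo, ← Real.range_sigmoid, ← Set.image_univ,
    integral_image_eq_integral_abs_deriv_smul MeasurableSet.univ
      (fun x _ => (Real.hasDerivAt_sigmoid x).hasDerivWithinAt)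
      Real.sigmoid_injective.injOn, setIntegral_univ]
  simp_rw [sigmoid_smul_beta_integrand]
  congr 2
  ring

lemma norm_exp_I_mul_mul (t s : ℝ) : ‖Complex.exp (Complex.I * t * s)‖ = 1 := by
  rw [show Complex.I * t * s = ((t * s : ℝ) : ℂ) * Complex.I by push_cast; ring]
  exact Complex.norm_exp_ofReal_mul_I _

lemma norm_Gamma_mul_Gamma_le {b : ℂ} (hb : 0 < b.re) (t : ℝ) :
    ‖Complex.Gamma (b - Complex.I * t) * Complex.Gamma (b + Complex.I * t)‖ ≤
      ‖Complex.Gamma (2 * b)‖ * ∫ s : ℝ, ‖sechPow b s‖ := by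
  rw [Gamma_mul_Gamma_eq_integral_sechPow hb, norm_mul]
  gcongr
  refine (norm_integral_le_integral_norm _).trans_eq ?_
  simp_rw [norm_mul, norm_exp_I_mul_mul, mul_one]

/-! ### The kernel `1 / (a² + t²)`. -/

lemma sq_add_sq_factor (a : ℂ) (t : ℝ) :
    a ^ 2 + (t : ℂ) ^ 2 = (a - Complex.I * t) * (a + Complex.I * t) := by
  linear_combination (t : ℂ) ^ 2 * Complex.I_sq

lemma sub_I_mul_ne_zero {a : ℂ} (ha : a.re ≠ 0) (t : ℝ) : a - Complex.I * t ≠ 0 := by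
  intro h
  apply ha
  simpa using congrArg Complex.re h

lemma add_I_mul_ne_zero {a : ℂ} (ha : a.re ≠ 0) (t : ℝ) : a + Complex.I * t ≠ 0 := by
  intro h
  apply ha
  simpa using congrArg Complex.re h

lemma sq_add_sq_ne_zero {a : ℂ} (ha : a.re ≠ 0) (t : ℝ) : a ^ 2 + (t : ℂ) ^ 2 ≠ 0 := by
  rw [sq_add_sq_factor]
  exact mul_ne_zero (sub_I_mul_ne_zero ha t) (add_I_mul_ne_zero ha t)

lemma continuous_inv_sq_add_sq {a : ℂ} (ha : a.re ≠ 0) :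
    Continuous fun t : ℝ => (a ^ 2 + (t : ℂ) ^ 2)⁻¹ :=
  Continuous.inv₀ (by fun_prop) (sq_add_sq_ne_zero ha)

/-- Used at `t` and `-t`, it bounds both factors of `a² + t²` from below, whence decay like `1 / (1
+ t²)`. -/
lemma one_add_abs_le_mul_norm_add_I_mul {a : ℂ} (ha : a.re ≠ 0) (t : ℝ) :
    1 + |t| ≤ (1 + (1 + ‖a‖) / |a.re|) * ‖a + Complex.I * t‖ := by
  have hr : 0 < |a.re| := abs_pos.2 ha
  have h1 : |a.re| ≤ ‖a + Complex.I * t‖ := by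
    simpa using Complex.abs_re_le_norm (a + Complex.I * t)
  have h2 : |t| ≤ ‖a + Complex.I * t‖ + ‖a‖ := by
    have := norm_sub_le (a + Complex.I * t) a
    simpa using this
  have h3 : 1 + ‖a‖ ≤ (1 + ‖a‖) / |a.re| * ‖a + Complex.I * t‖ := by
    rw [div_mul_eq_mul_div, le_div_iff₀ hr]
    gcongr
  linarith

lemma integrable_inv_sq_add_sq {a : ℂ} (ha : a.re ≠ 0) :
    Integrable fun t : ℝ => (a ^ 2 + (t : ℂ) ^ 2)⁻¹ := by
  set C := 1 + (1 + ‖a‖) / |a.re|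
  refine (integrable_inv_one_add_sq.const_mul (C ^ 2)).mono'
    (continuous_inv_sq_add_sq ha).aestronglyMeasurable (ae_of_all _ fun t => ?_)
  have h1 := one_add_abs_le_mul_norm_add_I_mul ha t
  have h2 := one_add_abs_le_mul_norm_add_I_mul ha (-t)
  rw [abs_neg, Complex.ofReal_neg, mul_neg, ← sub_eq_add_neg] at h2
  have h3 := mul_le_mul h2 h1 (by positivity) (by positivity)
  have h4 : 0 < ‖a ^ 2 + (t : ℂ) ^ 2‖ := norm_pos_iff.2 (sq_add_sq_ne_zero ha t)
  rw [norm_inv, ← div_eq_mul_inv, le_div_iff₀ (by positivity), inv_mul_le_iff₀ h4,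
    sq_add_sq_factor, norm_mul]
  have := sq_abs t
  have := abs_nonneg t
  nlinarith

/-! ### The Fourier pair `e^{-α|v|}` and `2α / (α² + t²)`. -/

lemma integrableOn_Ioi_exp_neg_mul_abs {α : ℂ} (c : ℂ) (h : (c - α).re < 0) :
    IntegrableOn (fun v : ℝ => Complex.exp (c * v) * Complex.exp (-α * |v|)) (Set.Ioi 0) := by
  refine (integrableOn_exp_mul_complex_Ioi h 0).congr_fun (fun v hv => ?_) measurableSet_Ioi
  simp only [abs_of_pos (Set.mem_Ioi.1 hv), ← Complex.exp_add]
  ring_nf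

lemma integrableOn_Iic_exp_neg_mul_abs {α : ℂ} (c : ℂ) (h : 0 < (c + α).re) :
    IntegrableOn (fun v : ℝ => Complex.exp (c * v) * Complex.exp (-α * |v|)) (Set.Iic 0) := by
  refine (integrableOn_exp_mul_complex_Iic h 0).congr_fun (fun v hv => ?_) measurableSet_Iic
  simp only [abs_of_nonpos (Set.mem_Iic.1 hv), ← Complex.exp_add, Complex.ofReal_neg]
  ring_nf

lemma integral_exp_mul_exp_neg_mul_abs {α : ℂ} (c : ℂ) (h₁ : (c - α).re < 0)
    (h₂ : 0 < (c + α).re) :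
    ∫ v : ℝ, Complex.exp (c * v) * Complex.exp (-α * |v|) = 2 * α / (α ^ 2 - c ^ 2) := by
  have e1 : ∫ v : ℝ in Set.Ioi 0, Complex.exp (c * v) * Complex.exp (-α * |v|) =
      -1 / (c - α) := by
    have := integral_exp_mul_complex_Ioi h₁ 0
    simp only [Complex.ofReal_zero, mul_zero, Complex.exp_zero] at this
    rw [← this]
    refine setIntegral_congr_fun measurableSet_Ioi fun v hv => ?_
    simp only [abs_of_pos (Set.mem_Ioi.1 hv), ← Complex.exp_add]
    ring_nf
  have e2 : ∫ v : ℝ in Set.Iic 0, Complex.exp (c * v) * Complex.exp (-α * |v|) =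
      1 / (c + α) := by
    have := integral_exp_mul_complex_Iic h₂ 0
    simp only [Complex.ofReal_zero, mul_zero, Complex.exp_zero] at this
    rw [← this]
    refine setIntegral_congr_fun measurableSet_Iic fun v hv => ?_
    simp only [abs_of_nonpos (Set.mem_Iic.1 hv), ← Complex.exp_add, Complex.ofReal_neg]
    ring_nf
  rw [← intervalIntegral.integral_Iic_add_Ioi (integrableOn_Iic_exp_neg_mul_abs c h₂)
    (integrableOn_Ioi_exp_neg_mul_abs c h₁), e1, e2]
  have n1 : c - α ≠ 0 := fun h => by simp [h] at h₁
  have n2 : c + α ≠ 0 := fun h => by simp [h] at h₂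
  have n3 : α ^ 2 - c ^ 2 ≠ 0 := by
    rw [show α ^ 2 - c ^ 2 = -((c - α) * (c + α)) by ring]
    exact neg_ne_zero.2 (mul_ne_zero n1 n2)
  field_simp
  ring

lemma fourier_exp_neg_mul_abs {α : ℂ} (hα : 0 < α.re) (w : ℝ) :
    𝓕 (fun v : ℝ => Complex.exp (-α * |v|)) w =
      2 * α * (α ^ 2 + ((2 * Real.pi * w : ℝ) : ℂ) ^ 2)⁻¹ := by
  rw [Real.fourier_real_eq_integral_exp_smul]
  have := integral_exp_mul_exp_neg_mul_abs (α := α) (-((2 * Real.pi * w : ℝ) : ℂ) * Complex.I)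
    (by simpa using hα) (by simpa using hα)
  simp only [smul_eq_mul]
  rw [← div_eq_mul_inv]
  convert this using 1
  · congr 1 with v
    congr 2
    push_cast
    ring
  · congr 1
    linear_combination ((2 * Real.pi * w : ℝ) : ℂ) ^ 2 * Complex.I_sq

/-- The Fourier transform of `t ↦ 1 / (α² + t²)`. -/
lemma integral_exp_mul_inv_sq_add_sq {α : ℂ} (hα : 0 < α.re) (u : ℝ) :
    ∫ t : ℝ, Complex.exp (Complex.I * t * u) * (α ^ 2 + (t : ℂ) ^ 2)⁻¹ =
      Real.pi / α * Complex.exp (-α * |u|) := by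
  have hα0 : α ≠ 0 := fun h => by simp [h] at hα
  have hf : Integrable fun v : ℝ => Complex.exp (-α * |v|) := by
    have h := (integrableOn_Iic_exp_neg_mul_abs (α := α) 0 (by simpa using hα)).union
      (integrableOn_Ioi_exp_neg_mul_abs (α := α) 0 (by simpa using hα))
    rw [Set.Iic_union_Ioi, integrableOn_univ] at h
    simpa using h
  have hF : 𝓕 (fun v : ℝ => Complex.exp (-α * |v|)) =
      fun w : ℝ => 2 * α * (α ^ 2 + ((2 * Real.pi * w : ℝ) : ℂ) ^ 2)⁻¹ :=
    funext (fourier_exp_neg_mul_abs hα)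
  have hF' : Integrable (𝓕 fun v : ℝ => Complex.exp (-α * |v|)) := by
    rw [hF]
    exact ((integrable_inv_sq_add_sq hα.ne').comp_mul_left'
      (by positivity : 2 * Real.pi ≠ 0)).const_mul _
  -- Fourier inversion at `u`; the substitution `t = 2πw` below removes the `2π` of the
  -- normalisation.
  have hinv := hf.fourierInv_fourier_eq hF' (v := u) (by fun_prop)
  rw [Real.fourierInv_eq', hF] at hinv
  have hsub := Measure.integral_comp_mul_left
    (fun t : ℝ => Complex.exp (Complex.I * t * u) * (α ^ 2 + (t : ℂ) ^ 2)⁻¹) (2 * Real.pi)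
  have hmul : ∫ w : ℝ, Complex.exp (↑(2 * Real.pi * inner ℝ w u) * Complex.I) •
      (2 * α * (α ^ 2 + ((2 * Real.pi * w : ℝ) : ℂ) ^ 2)⁻¹) =
      2 * α * ∫ w : ℝ, Complex.exp (Complex.I * ((2 * Real.pi * w : ℝ) : ℂ) * u) *
        (α ^ 2 + ((2 * Real.pi * w : ℝ) : ℂ) ^ 2)⁻¹ := by
    rw [← integral_const_mul]
    congr 1 with w
    have : (↑(2 * Real.pi * inner ℝ w u) * Complex.I : ℂ) =
        Complex.I * ((2 * Real.pi * w : ℝ) : ℂ) * u := by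
      simp
      ring
    rw [this, smul_eq_mul]
    ring
  rw [hmul, hsub, abs_of_pos (by positivity), Complex.real_smul] at hinv
  rw [← hinv]
  have hpi : (Real.pi : ℂ) ≠ 0 := by exact_mod_cast Real.pi_ne_zero
  generalize (∫ t : ℝ, Complex.exp (Complex.I * t * u) * (α ^ 2 + (t : ℂ) ^ 2)⁻¹) = I
  push_cast
  field_simp

/-! ### Absolute convergence and the convolution formula for `J`. -/

/-- The functional equation of `Γ`, applied to both factors of the integrand. -/
lemma gammaIntegrand_eq {a : ℂ} (ha : a.re ≠ 0) (ξ t : ℝ) :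
    gammaIntegrand a ξ t =
      Complex.Gamma (a + 1 - Complex.I * t) * Complex.Gamma (a + 1 + Complex.I * t) *
        ((a ^ 2 + (t : ℂ) ^ 2)⁻¹ * Complex.exp (-(Complex.I * t * ξ))) := by
  have h1 := sub_I_mul_ne_zero ha t
  have h2 := add_I_mul_ne_zero ha t
  rw [gammaIntegrand, sq_add_sq_factor, show a + 1 - Complex.I * t = a - Complex.I * t + 1 by ring,
    show a + 1 + Complex.I * t = a + Complex.I * t + 1 by ring, Complex.Gamma_add_one _ h1,
    Complex.Gamma_add_one _ h2]
  field_simp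

lemma continuous_Gamma_mul_Gamma {b : ℂ} (hb : 0 < b.re) :
    Continuous fun t : ℝ =>
      Complex.Gamma (b - Complex.I * t) * Complex.Gamma (b + Complex.I * t) := by
  have key : ∀ z : ℂ, 0 < z.re → ContinuousAt Complex.Gamma z := fun z hz =>
    (Complex.differentiableAt_Gamma z fun m h => by
      rw [h] at hz
      simp at hz
      linarith [(Nat.cast_nonneg m : (0 : ℝ) ≤ m)]).continuousAt
  refine continuous_iff_continuousAt.2 fun t => ContinuousAt.mul ?_ ?_
  · exact ContinuousAt.comp (f := fun t : ℝ => b - Complex.I * t) (key _ (by simpa using hb))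
      (by fun_prop)
  · exact ContinuousAt.comp (f := fun t : ℝ => b + Complex.I * t) (key _ (by simpa using hb))
      (by fun_prop)

lemma integrable_gammaIntegrand {a : ℂ} (ha : -1 < a.re) (ha0 : a.re ≠ 0) (ξ : ℝ) :
    Integrable (gammaIntegrand a ξ) := by
  have hb : 0 < (a + 1).re := by simp; linarith
  have h1 : Integrable fun t : ℝ =>
      (a ^ 2 + (t : ℂ) ^ 2)⁻¹ * Complex.exp (-(Complex.I * t * ξ)) := by
    refine (integrable_inv_sq_add_sq ha0).mul_bdd (c := 1) (by fun_prop) (ae_of_all _ fun t => ?_)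
    have := norm_exp_I_mul_mul (-t) ξ
    rw [Complex.ofReal_neg, mul_neg, neg_mul] at this
    exact this.le
  rw [funext (gammaIntegrand_eq ha0 ξ)]
  exact h1.bdd_mul (continuous_Gamma_mul_Gamma hb).aestronglyMeasurable
    (ae_of_all _ (norm_Gamma_mul_Gamma_le hb))

/-- `J` as a convolution, on either side of the imaginary axis: `α` is the one of `a`, `-a` with
positive real part. -/
lemma J_eq_integral_sechPow {a α : ℂ} (ha : -1 < a.re) (hα : 0 < α.re) (hsq : α ^ 2 = a ^ 2)
    (ξ : ℝ) :
    J a ξ = Complex.Gamma (2 * (a + 1)) * (Real.pi / α) *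
      ∫ s : ℝ, sechPow (a + 1) s * Complex.exp (-α * |s - ξ|) := by
  have ha0 : a.re ≠ 0 := by
    rcases sq_eq_sq_iff_eq_or_eq_neg.1 hsq with h | h
    · rw [← h]; exact hα.ne'
    · intro h0
      rw [h, Complex.neg_re, h0] at hα
      simp at hα
  have hb : 0 < (a + 1).re := by simp; linarith
  have hprod : Integrable (Function.uncurry fun t s : ℝ =>
      (α ^ 2 + (t : ℂ) ^ 2)⁻¹ * sechPow (a + 1) s *
        Complex.exp (Complex.I * t * ((s - ξ : ℝ) : ℂ))) (volume.prod volume) := by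
    refine ((integrable_inv_sq_add_sq hα.ne').mul_prod (integrable_sechPow hb)).mul_bdd (c := 1)
      (Continuous.aestronglyMeasurable (by fun_prop))
      (ae_of_all _ fun x => (norm_exp_I_mul_mul _ _).le)
  calc
    J a ξ = ∫ t : ℝ, Complex.Gamma (2 * (a + 1)) * ∫ s : ℝ, (α ^ 2 + (t : ℂ) ^ 2)⁻¹ *
        sechPow (a + 1) s * Complex.exp (Complex.I * t * ((s - ξ : ℝ) : ℂ)) := by
      unfold J
      congr 1 with t
      rw [gammaIntegrand_eq ha0, Gamma_mul_Gamma_eq_integral_sechPow hb, mul_assoc,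
        ← integral_mul_const, hsq]
      congr 2 with s
      rw [Complex.ofReal_sub, mul_sub, sub_eq_add_neg, Complex.exp_add]
      ring
    _ = Complex.Gamma (2 * (a + 1)) * ∫ s : ℝ, ∫ t : ℝ, (α ^ 2 + (t : ℂ) ^ 2)⁻¹ *
        sechPow (a + 1) s * Complex.exp (Complex.I * t * ((s - ξ : ℝ) : ℂ)) := by
      rw [integral_const_mul, integral_integral_swap hprod]
    _ = _ := by
      rw [mul_assoc]
      congr 1
      rw [← integral_const_mul]
      refine integral_congr_ae (ae_of_all _ fun s => ?_)
      have := integral_exp_mul_inv_sq_add_sq hα (s - ξ)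
      calc
        _ = sechPow (a + 1) s * ∫ t : ℝ, Complex.exp (Complex.I * t * ((s - ξ : ℝ) : ℂ)) *
            (α ^ 2 + (t : ℂ) ^ 2)⁻¹ := by
          rw [← integral_const_mul]
          refine integral_congr_ae (ae_of_all _ fun t => ?_)
          ring
        _ = _ := by
          rw [this]
          ring

/-! ### One-sided limits at the imaginary axis. -/

lemma continuousAt_Gamma_two_mul_add_one {p : ℂ} (hp : -1 < p.re) :
    ContinuousAt (fun a : ℂ => Complex.Gamma (2 * (a + 1))) p := by
  refine ContinuousAt.comp (f := fun a : ℂ => 2 * (a + 1))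
    (Complex.differentiableAt_Gamma _ fun m h => ?_).continuousAt (by fun_prop)
  have := congrArg Complex.re h
  simp at this
  linarith [(Nat.cast_nonneg m : (0 : ℝ) ≤ m)]

/-- The limit of `J` from the half-plane `0 < re (ε a)`, for `ε = ±1`. -/
lemma tendsto_J_halfPlane {p : ℂ} (hp_re : p.re = 0) (hp : p ≠ 0) {ε : ℂ} (hε : ε ^ 2 = 1)
    (ξ : ℝ) :
    Tendsto (fun a => J a ξ) (𝓝[{a : ℂ | 0 < (ε * a).re}] p)
      (𝓝 (Complex.Gamma (2 * (p + 1)) * (Real.pi / (ε * p)) *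
        ∫ s : ℝ, sechPow (p + 1) s * Complex.exp (-(ε * p) * |s - ξ|))) := by
  have hε0 : ε ≠ 0 := by rintro rfl; simp at hε
  have hev : ∀ᶠ a in 𝓝[{a : ℂ | 0 < (ε * a).re}] p, 0 < (ε * a).re ∧ -(1 / 2) < a.re := by
    refine Eventually.and self_mem_nhdsWithin (nhdsWithin_le_nhds ?_)
    exact Complex.continuous_re.continuousAt.eventually_const_lt (by rw [hp_re]; norm_num)
  have hcongr : ∀ᶠ a in 𝓝[{a : ℂ | 0 < (ε * a).re}] p,
      Complex.Gamma (2 * (a + 1)) * (Real.pi / (ε * a)) *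
        ∫ s : ℝ, sechPow (a + 1) s * Complex.exp (-(ε * a) * |s - ξ|) = J a ξ := by
    filter_upwards [hev] with a ha
    exact (J_eq_integral_sechPow (by linarith [ha.2]) ha.1 (by rw [mul_pow, hε, one_mul]) ξ).symm
  refine Tendsto.congr' hcongr (Tendsto.mul (Tendsto.mul ?_ ?_) ?_)
  · exact (continuousAt_Gamma_two_mul_add_one (by rw [hp_re]; norm_num)).tendsto.mono_left
      nhdsWithin_le_nhds
  · refine Tendsto.mono_left (ContinuousAt.tendsto ?_) nhdsWithin_le_nhds
    exact continuousAt_const.div (by fun_prop) (mul_ne_zero hε0 hp)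
  -- Near `p`, `re (a + 1) > 1/2`, and the exponential has modulus at most 1 because `re (ε a) > 0`.
  · refine tendsto_integral_filter_of_dominated_convergence (fun s => ‖sechPow (1 / 2) s‖)
      (Eventually.of_forall fun a => Continuous.aestronglyMeasurable
        ((continuous_sechPow _).mul (by fun_prop))) ?_
      (integrable_sechPow (by norm_num)).norm (ae_of_all _ fun s => ?_)
    · filter_upwards [hev] with a ha
      refine ae_of_all _ fun s => ?_
      rw [norm_mul]
      refine (mul_le_of_le_one_right (norm_nonneg _) ?_).trans (norm_sechPow_le ?_ s)
      rotate_left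
      · norm_num
        linarith [ha.2]
      · rw [Complex.norm_exp, Complex.re_mul_ofReal, Complex.neg_re]
        refine Real.exp_le_one_iff.2 ?_
        have := mul_nonneg ha.1.le (abs_nonneg (s - ξ))
        linarith
    · refine Tendsto.mono_left (ContinuousAt.tendsto ?_) nhdsWithin_le_nhds
      refine ContinuousAt.mul ?_ (by fun_prop)
      exact ((continuous_sechPow_left s).comp (continuous_add_const 1)).continuousAt

/-! ### Evaluation of the jump. -/

lemma integrable_sechPow_mul_exp {b : ℂ} (hb : 0 < b.re) {q : ℂ} (hq : q.re = 0)
    {g : ℝ → ℝ} (hg : Continuous g) :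
    Integrable fun s : ℝ => sechPow b s * Complex.exp (q * g s) := by
  refine (integrable_sechPow hb).mul_bdd (c := 1)
    (Continuous.aestronglyMeasurable (by fun_prop)) (ae_of_all _ fun s => ?_)
  rw [Complex.norm_exp, Complex.re_mul_ofReal, hq]
  simp

/-- The Fourier transform of `sechPow (p + 1)` at the points `p` and `-p` of the imaginary axis. -/
lemma Gamma_mul_integral_sechPow_mul_exp {p q : ℂ} (hp_re : p.re = 0) (hq : q = p ∨ q = -p) :
    Complex.Gamma (2 * (p + 1)) * ∫ s : ℝ, sechPow (p + 1) s * Complex.exp (q * s) =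
      Complex.Gamma (1 + 2 * p) := by
  have hp' : p = Complex.I * (p.im : ℂ) := by
    apply Complex.ext <;> simp [hp_re]
  have hb : 0 < (p + 1).re := by simp [hp_re]
  rcases hq with rfl | rfl
  -- At this real `t`, `I * t` equals the exponent, so one Gamma factor is `Γ(1)`.
  · have := Gamma_mul_Gamma_eq_integral_sechPow hb q.im
    rw [← hp'] at this
    rw [← this, show q + 1 - q = 1 by ring, Complex.Gamma_one, one_mul]
    congr 1
    ring
  · have := Gamma_mul_Gamma_eq_integral_sechPow hb (-p.im)
    rw [Complex.ofReal_neg, mul_neg, ← hp'] at this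
    rw [← this, show p + 1 + -p = 1 by ring, Complex.Gamma_one, mul_one]
    congr 1
    ring

lemma exp_neg_mul_abs_add_exp_mul_abs (p : ℂ) (x : ℝ) :
    Complex.exp (-p * |x|) + Complex.exp (p * |x|) =
      Complex.exp (p * x) + Complex.exp (-p * x) := by
  rcases abs_choice x with h | h <;> rw [h]
  · exact add_comm _ _
  · simp

theorem corollary3 (ξ : ℝ) (p : ℂ) (hp_re : p.re = 0) (hp : p ≠ 0) :
    (∀ a : ℂ, -1 < a.re → a.re ≠ 0 → Integrable (gammaIntegrand a ξ) volume) ∧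
    HasJumpAcrossImaginaryAxis (fun a => J a ξ) p
      (4 * (Real.pi : ℂ) * Complex.cosh (p * ξ) * Complex.Gamma (2 * p)) := by
  refine ⟨fun a ha ha0 => integrable_gammaIntegrand ha ha0 ξ, _, _,
    -- The left limit carries `π / (-p)`, so subtracting it adds the two integrals.
    by simpa using tendsto_J_halfPlane hp_re hp (ε := 1) (by norm_num) ξ,
    by simpa using tendsto_J_halfPlane hp_re hp (ε := -1) (by norm_num) ξ, ?_⟩
  have hb : 0 < (p + 1).re := by simp [hp_re]
  have hnp : (-p).re = 0 := by simp [hp_re]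
  have hsum : (∫ s : ℝ, sechPow (p + 1) s * Complex.exp (-(p * |s - ξ|))) +
      ∫ s : ℝ, sechPow (p + 1) s * Complex.exp (p * |s - ξ|) =
      Complex.exp (-p * ξ) * (∫ s : ℝ, sechPow (p + 1) s * Complex.exp (p * s)) +
      Complex.exp (p * ξ) * ∫ s : ℝ, sechPow (p + 1) s * Complex.exp (-p * s) := by
    simp_rw [← neg_mul]
    rw [← integral_add (integrable_sechPow_mul_exp hb hnp (by fun_prop))
      (integrable_sechPow_mul_exp hb hp_re (by fun_prop)), ← integral_const_mul,
      ← integral_const_mul,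
      ← integral_add ((integrable_sechPow_mul_exp hb hp_re (g := fun s => s) continuous_id).const_mul _)
        ((integrable_sechPow_mul_exp hb hnp (g := fun s => s) continuous_id).const_mul _)]
    congr 1 with s
    rw [← mul_add, exp_neg_mul_abs_add_exp_mul_abs, Complex.ofReal_sub, mul_sub, mul_sub,
      sub_eq_add_neg, sub_eq_add_neg, Complex.exp_add, Complex.exp_add]
    simp only [neg_mul, neg_neg]
    ring
  have h1 := Gamma_mul_integral_sechPow_mul_exp hp_re (Or.inl rfl)
  have h2 := Gamma_mul_integral_sechPow_mul_exp hp_re (Or.inr rfl)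
  have h3 : Complex.Gamma (1 + 2 * p) = 2 * p * Complex.Gamma (2 * p) := by
    rw [add_comm, Complex.Gamma_add_one _ (mul_ne_zero two_ne_zero hp)]
  have h4 : Real.pi / p * (2 * p) = 2 * (Real.pi : ℂ) := by field_simp
  rw [h3] at h1 h2
  rw [Complex.cosh, ← neg_mul, div_neg]
  linear_combination Complex.Gamma (2 * (p + 1)) * (Real.pi / p) * hsum +
    Real.pi / p * Complex.exp (-p * ξ) * h1 + Real.pi / p * Complex.exp (p * ξ) * h2 +
    (Complex.exp (p * ξ) + Complex.exp (-p * ξ)) * Complex.Gamma (2 * p) * h4
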